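/- Let $w=w_1w_2w_3\cdots$ be an infinite word over $\{0,1\}$ that contains infinitely many $1$'s. Put $G(0)=0$ and, for $i\ge 1$, let $G(i)$ be the position of the $i$-th $1$ in $w$; the gap function of $w$ is $g(i)=G(i)-G(i-1)$ for $i\ge 1$. A function $h$ on the positive integers is called blockwise injective if $h(i)=h(j)$ with $i<j$ implies $h(i)=h(i+1)=\cdots=h(j)$. The subword complexity $f_w(n)$ is the number of distinct words of length $n$ that occur as blocks of consecutive letters in $w$. Let $a$ and $b$ be two integers. There exist an infinite binary word $w$ with infinitely many $1$'s and blockwise injective gap function and a positive integer $N$ such that $f_w(n)=an+b$ for all integers $n\ge N$ if and only if one of the following two conditions holds: 1) $a\ge 2$; 2) $a=0$ and $b\ge 1$. -/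

import Mathlib

/-- An infinite binary word `w₁w₂w₃…`. Positions start at `1`: the letter at position `i + 1`
is `w i`. -/
abbrev InfBinaryWord : Type := ℕ → Fin 2

namespace InfBinaryWord

/-- The letter `1` occurs infinitely often in `w`, so that the gap function is defined. -/
def HasInfinitelyManyOnes (w : InfBinaryWord) : Prop :=
  {i : ℕ | w i = 1}.Infinite

/-- The `1`-distribution function `G`: `G 0 = 0`, and for `i ≥ 1`, `G i` is the position
(counted from `1`) of the `i`-th `1` of `w`. -/
noncomputable def oneDistribution (w : InfBinaryWord) : ℕ → ℕ
  | 0 => 0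
  | i + 1 => Nat.nth (fun k => w k = 1) i + 1

/-- The gap function, indexed from `0`: `gap w i` is `G (i + 1) - G i`, that is, the value
`g (i + 1)` of the gap function `g i = G i - G (i - 1)`, `i ≥ 1`. -/
noncomputable def gap (w : InfBinaryWord) (i : ℕ) : ℕ :=
  oneDistribution w (i + 1) - oneDistribution w i

/-- The set of subwords (blocks of consecutive letters) of `w` of length `n`. -/
def subwords (w : InfBinaryWord) (n : ℕ) : Set (Fin n → Fin 2) :=
  {u | ∃ i : ℕ, ∀ k : Fin n, u k = w (i + k)}

/-- The subword complexity function `f_w`: the number of distinct subwords of length `n`. -/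
noncomputable def complexity (w : InfBinaryWord) (n : ℕ) : ℕ :=
  (subwords w n).ncard

end InfBinaryWord

/-- `h` is blockwise injective: `h i = h j` with `i < j` forces `h i = h (i+1) = ⋯ = h j`. -/
def BlockwiseInjective (h : ℕ → ℕ) : Prop :=
  ∀ i j : ℕ, i < j → h i = h j → ∀ k : ℕ, i ≤ k → k ≤ j → h k = h i

open Filter Finset

namespace InfBinaryWord

variable {w : InfBinaryWord}

/-! A blockwise injective gap function `g` either is eventually constant or tends to infinity. If it
is eventually constant, `w` is eventually periodic and `f_w` is bounded, which forces `a = 0` and `b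
≥ 1`. If `g → ∞`, all `n + 1` blocks with at most one `1` occur, and blocks with at least two `1`s
realise ever more different inner gaps. Hence `f_w(n) - n → ∞` and `a ≥ 2`
(`slope_of_complexity_eq`).

Conversely, slope `0` comes from `0^(b-1) 1 1 1 ⋯`. For slope `≥ 2`, take `g` injective: a block
with two `1`s then determines its starting index, and counting starts gives `f_w(n) = n + 1 + ∑ min
(g j) (n - g (j+1))` with truncated subtraction (`complexity_eq_sum`). Each term is `min n (g j + g
(j+1)) - min n (g (j+1))`. If `g j + g (j+1)` is itself a later gap at a fixed delay, the sum
telescopes to a linear function of `n`. The delay sets the slope, and two free initial gaps set the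
constant term. -/

theorem eq_zero_of_ne_one {x : Fin 2} (h : x ≠ 1) : x = 0 := by
  omega

/-! ### Positions of the `1`s and gaps. -/

theorem HasInfinitelyManyOnes.oneDistribution_strictMono (hw : w.HasInfinitelyManyOnes) :
    StrictMono w.oneDistribution := by
  refine strictMono_nat_of_lt_succ fun n => ?_
  cases n with
  | zero => simp [oneDistribution]
  | succ n =>
    have := Nat.nth_strictMono (p := fun k => w k = 1) hw (Nat.lt_succ_self n)
    simpa [oneDistribution] using this

theorem HasInfinitelyManyOnes.apply_eq_one_iff (hw : w.HasInfinitelyManyOnes) (i : ℕ) :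
    w i = 1 ↔ ∃ j, w.oneDistribution (j + 1) = i + 1 := by
  classical
  constructor
  · intro h
    exact ⟨Nat.count (fun k => w k = 1) i, by
      simp only [oneDistribution]; rw [Nat.nth_count (p := fun k => w k = 1) h]⟩
  · rintro ⟨j, hj⟩
    have := Nat.nth_mem_of_infinite (p := fun k => w k = 1) hw j
    simp only [oneDistribution, Nat.add_right_cancel_iff] at hj
    rwa [hj] at this

theorem HasInfinitelyManyOnes.oneDistribution_succ (hw : w.HasInfinitelyManyOnes) (j : ℕ) :
    w.oneDistribution (j + 1) = w.oneDistribution j + w.gap j := by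
  have := hw.oneDistribution_strictMono (Nat.lt_succ_self j)
  simp only [gap, Nat.succ_eq_add_one] at *
  omega

theorem HasInfinitelyManyOnes.gap_pos (hw : w.HasInfinitelyManyOnes) (j : ℕ) : 0 < w.gap j := by
  have := hw.oneDistribution_strictMono (Nat.lt_succ_self j)
  simp only [gap, Nat.succ_eq_add_one] at *
  omega

theorem HasInfinitelyManyOnes.exists_mem_Ico (hw : w.HasInfinitelyManyOnes) (i : ℕ) :
    ∃ j, w.oneDistribution j ≤ i ∧ i < w.oneDistribution (j + 1) := by
  induction i with
  | zero => exact ⟨0, le_rfl, hw.oneDistribution_strictMono Nat.zero_lt_one⟩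
  | succ i ih =>
    obtain ⟨j, h1, h2⟩ := ih
    by_cases h : i + 1 < w.oneDistribution (j + 1)
    · exact ⟨j, by omega, h⟩
    · have := hw.oneDistribution_strictMono (Nat.lt_succ_self (j + 1))
      exact ⟨j + 1, by omega, by simp only [Nat.succ_eq_add_one] at this; omega⟩

/-! ### Blocks with at most one `1` and blocks with at least two. -/

/-- The block of length `n` of `w` that starts at index `i`. -/
def window (w : InfBinaryWord) (n i : ℕ) : Fin n → Fin 2 := fun k => w (i + k)

theorem subwords_eq_range (w : InfBinaryWord) (n : ℕ) : w.subwords n = Set.range (w.window n) := by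
  ext u
  simp only [subwords, Set.mem_ofPred_eq, Set.mem_range, window, funext_iff, eq_comm]

/-- The binary words of length `n` with at most one letter `1`. -/
def sparseWords (n : ℕ) : Set (Fin n → Fin 2) :=
  insert 0 (Set.range fun p : Fin n => Pi.single p 1)

theorem ncard_sparseWords (n : ℕ) : (sparseWords n).ncard = n + 1 := by
  rw [sparseWords, Set.ncard_insert_of_notMem, ← Set.image_univ, Set.ncard_image_of_injective,
    Set.ncard_univ, Nat.card_eq_fintype_card, Fintype.card_fin]
  · intro p q h
    by_contra hpq
    have := congrFun h p
    simp [hpq] at this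
  · rintro ⟨p, h⟩
    have := congrFun h p
    simp at this

/-- The starting indices of the blocks of length `n` of `w` with at least two letters `1`. -/
def denseStarts (w : InfBinaryWord) (n : ℕ) : Set ℕ :=
  {i | ∃ j, w.oneDistribution j ≤ i ∧ i < w.oneDistribution (j + 1) ∧
    w.oneDistribution (j + 2) ≤ i + n}

theorem HasInfinitelyManyOnes.window_eq_zero (hw : w.HasInfinitelyManyOnes) {n i j : ℕ}
    (h1 : w.oneDistribution j ≤ i) (h2 : i + n < w.oneDistribution (j + 1)) :
    w.window n i = 0 := by
  ext1 k
  refine eq_zero_of_ne_one fun h => ?_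
  obtain ⟨l, hl⟩ := (hw.apply_eq_one_iff _).1 h
  have hk := k.2
  have h3 : j < l + 1 := hw.oneDistribution_strictMono.lt_iff_lt.1 (by omega)
  have h4 : l + 1 < j + 1 := hw.oneDistribution_strictMono.lt_iff_lt.1 (by omega)
  omega

theorem HasInfinitelyManyOnes.window_eq_single (hw : w.HasInfinitelyManyOnes) {n i j : ℕ}
    (p : Fin n) (h1 : w.oneDistribution j ≤ i) (hp : w.oneDistribution (j + 1) = i + p + 1)
    (h2 : i + n < w.oneDistribution (j + 2)) : w.window n i = Pi.single p 1 := by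
  ext1 k
  by_cases hk : k = p
  · subst hk
    rw [Pi.single_eq_same]
    exact (hw.apply_eq_one_iff _).2 ⟨j, hp⟩
  · rw [Pi.single_eq_of_ne hk]
    refine eq_zero_of_ne_one fun h => ?_
    obtain ⟨l, hl⟩ := (hw.apply_eq_one_iff _).1 h
    have hk' := k.2
    have h3 : j < l + 1 := hw.oneDistribution_strictMono.lt_iff_lt.1 (by omega)
    have h4 : l + 1 < j + 2 := hw.oneDistribution_strictMono.lt_iff_lt.1 (by omega)
    obtain rfl : l = j := by omega
    exact hk (Fin.ext (by omega))

theorem HasInfinitelyManyOnes.window_mem_sparseWords (hw : w.HasInfinitelyManyOnes) {n i : ℕ}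
    (hi : i ∉ w.denseStarts n) : w.window n i ∈ sparseWords n := by
  obtain ⟨j, h1, h2⟩ := hw.exists_mem_Ico i
  have h3 : i + n < w.oneDistribution (j + 2) := by
    by_contra h
    exact hi ⟨j, h1, h2, by omega⟩
  by_cases h4 : i + n < w.oneDistribution (j + 1)
  · exact Or.inl (hw.window_eq_zero h1 h4)
  · exact Or.inr ⟨⟨w.oneDistribution (j + 1) - 1 - i, by omega⟩,
      (hw.window_eq_single _ h1 (by simp only; omega) h3).symm⟩

theorem HasInfinitelyManyOnes.window_notMem_sparseWords (hw : w.HasInfinitelyManyOnes) {n i : ℕ}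
    (hi : i ∈ w.denseStarts n) : w.window n i ∉ sparseWords n := by
  obtain ⟨j, h1, h2, h3⟩ := hi
  have h4 : w.oneDistribution (j + 1) < w.oneDistribution (j + 2) :=
    hw.oneDistribution_strictMono (Nat.lt_succ_self _)
  let p : Fin n := ⟨w.oneDistribution (j + 1) - 1 - i, by omega⟩
  let q : Fin n := ⟨w.oneDistribution (j + 2) - 1 - i, by omega⟩
  have hp : w.window n i p = 1 :=
    (hw.apply_eq_one_iff _).2 ⟨j, by simp only [p]; omega⟩
  have hq : w.window n i q = 1 :=
    (hw.apply_eq_one_iff _).2 ⟨j + 1, by simp only [q, add_assoc, Nat.reduceAdd]; omega⟩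
  have hpq : p ≠ q := by
    simp only [p, q, ne_eq, Fin.mk.injEq]; omega
  rintro (h | ⟨r, h⟩)
  · simp [h] at hp
  · rw [← h] at hp hq
    simp only [Pi.single_apply] at hp hq
    simp only [ite_eq_left_iff, zero_ne_one, imp_false, not_not] at hp hq
    exact hpq (hp.trans hq.symm)

/-- Two consecutive gaps larger than `n` isolate a `1`, and a block of length `n` can slide over it
to place it anywhere. -/
theorem HasInfinitelyManyOnes.sparseWords_subset_subwords (hw : w.HasInfinitelyManyOnes)
    (hg : Tendsto w.gap atTop atTop) (n : ℕ) : sparseWords n ⊆ w.subwords n := by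
  obtain ⟨j, hj⟩ := eventually_atTop.1 (hg.eventually_ge_atTop (n + 1))
  have h1 := hj j le_rfl
  have h2 := hj (j + 1) (by omega)
  have h3 := hw.oneDistribution_succ j
  have h4 := hw.oneDistribution_succ (j + 1)
  simp only [add_assoc, Nat.reduceAdd] at h4
  rw [subwords_eq_range]
  rintro u (rfl | ⟨p, rfl⟩)
  · exact ⟨_, hw.window_eq_zero (le_refl (w.oneDistribution j)) (by omega)⟩
  · have hp := p.2
    exact ⟨w.oneDistribution (j + 1) - 1 - p,
      hw.window_eq_single (j := j) p (by omega) (by omega) (by omega)⟩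

theorem HasInfinitelyManyOnes.complexity_eq (hw : w.HasInfinitelyManyOnes)
    (hg : Tendsto w.gap atTop atTop) (n : ℕ) :
    w.complexity n = n + 1 + (w.window n '' w.denseStarts n).ncard := by
  have h : w.subwords n = sparseWords n ∪ w.window n '' w.denseStarts n := by
    refine Set.Subset.antisymm ?_ (Set.union_subset (hw.sparseWords_subset_subwords hg n) ?_)
    · rw [subwords_eq_range]
      rintro _ ⟨i, rfl⟩
      by_cases hi : i ∈ w.denseStarts n
      · exact Or.inr ⟨i, hi, rfl⟩
      · exact Or.inl (hw.window_mem_sparseWords hi)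
    · rw [subwords_eq_range]
      exact Set.image_subset_range _ _
  rw [complexity, h, Set.ncard_union_eq _ (Set.toFinite _) (Set.toFinite _), ncard_sparseWords]
  rw [Set.disjoint_right]
  rintro _ ⟨i, hi, rfl⟩
  exact hw.window_notMem_sparseWords hi

/-- The first `1` of one block is copied to the same offset in the other, whose first `1` therefore
comes no later. Exchanging the blocks gives equality. -/
theorem HasInfinitelyManyOnes.oneDistribution_le_of_window_eq (hw : w.HasInfinitelyManyOnes)
    {n i i' j j' : ℕ} (h : w.window n i = w.window n i')
    (h2 : i < w.oneDistribution (j + 1)) (h1' : w.oneDistribution j' ≤ i')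
    (hn : w.oneDistribution (j + 1) ≤ i + n) :
    w.oneDistribution (j' + 1) + i ≤ w.oneDistribution (j + 1) + i' := by
  let p : Fin n := ⟨w.oneDistribution (j + 1) - 1 - i, by omega⟩
  have hp : w.window n i p = 1 := (hw.apply_eq_one_iff _).2 ⟨j, by simp only [p]; omega⟩
  rw [h] at hp
  obtain ⟨l, hl⟩ := (hw.apply_eq_one_iff _).1 hp
  simp only [p] at hl
  have h3 : j' < l + 1 := hw.oneDistribution_strictMono.lt_iff_lt.1 (by omega)
  have h4 := hw.oneDistribution_strictMono.monotone h3
  simp only [Nat.succ_eq_add_one] at h4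
  omega

theorem HasInfinitelyManyOnes.oneDistribution_add_two_le_of_window_eq
    (hw : w.HasInfinitelyManyOnes) {n i i' j j' : ℕ} (h : w.window n i = w.window n i')
    (h2 : i < w.oneDistribution (j + 1))
    (he : w.oneDistribution (j' + 1) + i = w.oneDistribution (j + 1) + i')
    (hn : w.oneDistribution (j + 2) ≤ i + n) :
    w.oneDistribution (j' + 2) + i ≤ w.oneDistribution (j + 2) + i' := by
  have h0 : w.oneDistribution (j + 1) < w.oneDistribution (j + 2) :=
    hw.oneDistribution_strictMono (Nat.lt_succ_self _)
  let p : Fin n := ⟨w.oneDistribution (j + 2) - 1 - i, by omega⟩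
  have hp : w.window n i p = 1 := (hw.apply_eq_one_iff _).2 ⟨j + 1, by simp only [p, add_assoc, Nat.reduceAdd]; omega⟩
  rw [h] at hp
  obtain ⟨l, hl⟩ := (hw.apply_eq_one_iff _).1 hp
  simp only [p] at hl
  have h3 : j' + 1 < l + 1 := hw.oneDistribution_strictMono.lt_iff_lt.1 (by omega)
  have h4 := hw.oneDistribution_strictMono.monotone h3
  simp only [Nat.succ_eq_add_one] at h4
  have h5 : w.oneDistribution (j' + 2) = w.oneDistribution (j' + 1 + 1) := rfl
  omega

/-- A block with at least two letters `1` determines the position of its first letter `1` and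
the gap that follows it. -/
theorem HasInfinitelyManyOnes.gap_eq_of_window_eq (hw : w.HasInfinitelyManyOnes)
    {n i i' j j' : ℕ} (h : w.window n i = w.window n i')
    (h1 : w.oneDistribution j ≤ i) (h2 : i < w.oneDistribution (j + 1))
    (h3 : w.oneDistribution (j + 2) ≤ i + n)
    (h1' : w.oneDistribution j' ≤ i') (h2' : i' < w.oneDistribution (j' + 1))
    (h3' : w.oneDistribution (j' + 2) ≤ i' + n) :
    w.oneDistribution (j' + 1) + i = w.oneDistribution (j + 1) + i' ∧
      w.gap (j + 1) = w.gap (j' + 1) := by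
  have h4 := hw.oneDistribution_succ (j + 1)
  have h4' := hw.oneDistribution_succ (j' + 1)
  simp only [add_assoc, Nat.reduceAdd] at h4 h4'
  have h5 := hw.oneDistribution_le_of_window_eq h h2 h1' (by omega)
  have h5' := hw.oneDistribution_le_of_window_eq h.symm h2' h1 (by omega)
  have h6 := hw.oneDistribution_add_two_le_of_window_eq (j := j) (j' := j') h h2 (by omega) h3
  have h6' := hw.oneDistribution_add_two_le_of_window_eq (j := j') (j' := j) h.symm h2'
    (by omega) h3'
  omega

/-! ### Exact complexity for injective gaps. -/

theorem HasInfinitelyManyOnes.window_injOn (hw : w.HasInfinitelyManyOnes)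
    (hg : Function.Injective w.gap) (n : ℕ) : Set.InjOn (w.window n) (w.denseStarts n) := by
  rintro i ⟨j, h1, h2, h3⟩ i' ⟨j', h1', h2', h3'⟩ h
  obtain ⟨h4, h5⟩ := hw.gap_eq_of_window_eq h h1 h2 h3 h1' h2' h3'
  have := hg h5
  obtain rfl : j = j' := by omega
  omega

/-- With `G = w.oneDistribution`, a start `i` in `[G j, G (j+1))` is dense exactly when `i ≥ G (j+2)
- n`, so it ranges over the last `min (g j) (n - g (j+1))` indices of that interval. -/
theorem HasInfinitelyManyOnes.ncard_denseStarts_inter_Iio (hw : w.HasInfinitelyManyOnes)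
    (n J : ℕ) : (w.denseStarts n ∩ Set.Iio (w.oneDistribution J)).ncard =
      ∑ j ∈ range J, min (w.gap j) (n - w.gap (j + 1)) := by
  induction J with
  | zero => simp [oneDistribution]
  | succ J ih =>
    have h1 := hw.oneDistribution_succ J
    have h2 := hw.oneDistribution_succ (J + 1)
    simp only [add_assoc, Nat.reduceAdd] at h2
    have h : w.denseStarts n ∩ Set.Iio (w.oneDistribution (J + 1)) =
        (w.denseStarts n ∩ Set.Iio (w.oneDistribution J)) ∪
          Set.Ico (max (w.oneDistribution J) (w.oneDistribution (J + 2) - n))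
            (w.oneDistribution (J + 1)) := by
      ext i
      simp only [Set.mem_inter_iff, Set.mem_Iio, Set.mem_union, Set.mem_Ico, sup_le_iff]
      constructor
      · rintro ⟨hi, hi'⟩
        by_cases h3 : i < w.oneDistribution J
        · exact Or.inl ⟨hi, h3⟩
        · obtain ⟨j, h4, h5, h6⟩ := hi
          have h7 : j < J + 1 := hw.oneDistribution_strictMono.lt_iff_lt.1 (by omega)
          have h8 : J < j + 1 := hw.oneDistribution_strictMono.lt_iff_lt.1 (by omega)
          obtain rfl : j = J := by omega
          exact Or.inr (by omega)
      · rintro (⟨hi, hi'⟩ | hi)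
        · exact ⟨hi, by omega⟩
        · exact ⟨⟨J, by omega, by omega, by omega⟩, hi.2⟩
    rw [h, Set.ncard_union_eq _ ((Set.finite_Iio _).inter_of_right _) (Set.finite_Ico _ _), ih,
      sum_range_succ, ← Finset.coe_Ico, Set.ncard_coe_finset, Nat.card_Ico]
    · omega
    · rw [Set.disjoint_left]
      rintro i ⟨-, hi⟩ ⟨hi', -⟩
      simp only [Set.mem_Iio, sup_le_iff] at hi hi'
      omega

theorem HasInfinitelyManyOnes.complexity_eq_sum (hw : w.HasInfinitelyManyOnes)
    (hg : Function.Injective w.gap) {n J : ℕ} (hJ : ∀ j, J ≤ j → n ≤ w.gap (j + 1)) :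
    w.complexity n = n + 1 + ∑ j ∈ range J, min (w.gap j) (n - w.gap (j + 1)) := by
  rw [hw.complexity_eq hg.nat_tendsto_atTop, (hw.window_injOn hg n).ncard_image,
    ← hw.ncard_denseStarts_inter_Iio, Set.inter_eq_left.2]
  rintro i ⟨j, h1, h2, h3⟩
  have h4 := hw.oneDistribution_succ (j + 1)
  simp only [add_assoc, Nat.reduceAdd] at h4
  have h5 : j < J := by
    by_contra h
    have := hJ j (by omega)
    omega
  exact lt_of_lt_of_le h2 (hw.oneDistribution_strictMono.monotone h5)

/-! ### Necessity: growth of the complexity. -/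

theorem HasInfinitelyManyOnes.exists_add_le_complexity (hw : w.HasInfinitelyManyOnes)
    (hg : Tendsto w.gap atTop atTop) (K : ℕ) :
    ∃ N, ∀ n, N ≤ n → n + 1 + K ≤ w.complexity n := by
  have hg' : Tendsto (fun j => w.gap (j + 1)) atTop atTop := hg.comp (tendsto_add_atTop_nat 1)
  have hinf : (Set.range fun j => w.gap (j + 1)).Infinite :=
    Set.infinite_of_not_bddAbove (not_bddAbove_of_tendsto_atTop hg')
  obtain ⟨t, ht, htK⟩ := hinf.exists_subset_card_eq K
  have ht' : ∀ v ∈ t, ∃ j, w.gap (j + 1) = v := fun v hv => ht hv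
  choose! f hf using ht'
  refine ⟨t.sup id + 1, fun n hn => ?_⟩
  rw [hw.complexity_eq hg]
  have hle : ∀ v ∈ t, v + 1 ≤ n := fun v hv =>
    (Nat.succ_le_succ (Finset.le_sup (f := id) hv)).trans hn
  -- The block starts on a letter `1`, so length `v + 1` is just enough to reach the next `1` across
  -- a gap `v`.
  have key : ∀ v ∈ t, w.oneDistribution (f v) ≤ w.oneDistribution (f v + 1) - 1 ∧
      w.oneDistribution (f v + 1) - 1 < w.oneDistribution (f v + 1) ∧
      w.oneDistribution (f v + 2) ≤ w.oneDistribution (f v + 1) - 1 + n := by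
    intro v hv
    have h1 := hw.oneDistribution_succ (f v)
    have h2 := hw.gap_pos (f v)
    have h3 := hw.oneDistribution_succ (f v + 1)
    simp only [add_assoc, Nat.reduceAdd] at h3
    have h4 := hf v hv
    have h5 := hle v hv
    omega
  have hinj : Set.InjOn (fun v => w.window n (w.oneDistribution (f v + 1) - 1)) (t : Set ℕ) := by
    intro v hv v' hv' h
    obtain ⟨h1, h2, h3⟩ := key v hv
    obtain ⟨h1', h2', h3'⟩ := key v' hv'
    have := (hw.gap_eq_of_window_eq h h1 h2 h3 h1' h2' h3').2
    rwa [hf v hv, hf v' hv'] at this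
  refine Nat.add_le_add_left ?_ _
  rw [← htK, ← Set.ncard_coe_finset, ← hinj.ncard_image]
  refine Set.ncard_le_ncard ?_ (Set.toFinite _)
  rintro _ ⟨v, hv, rfl⟩
  exact ⟨_, ⟨f v, key v hv⟩, rfl⟩

theorem complexity_pos (w : InfBinaryWord) (n : ℕ) : 0 < w.complexity n := by
  rw [complexity, subwords_eq_range, Set.ncard_pos (Set.toFinite _)]
  exact Set.range_nonempty _

/-- If the gaps are eventually constant, then the complexity is bounded. -/
theorem HasInfinitelyManyOnes.exists_complexity_le (hw : w.HasInfinitelyManyOnes) {J c : ℕ}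
    (hc : ∀ j, J ≤ j → w.gap j = c) : ∃ C, ∀ n, w.complexity n ≤ C := by
  have hpos : 0 < c := hc J le_rfl ▸ hw.gap_pos J
  have hper : ∀ i, w.oneDistribution J ≤ i → w (i + c) = w i := by
    intro i hi
    have key : w (i + c) = 1 ↔ w i = 1 := by
      rw [hw.apply_eq_one_iff, hw.apply_eq_one_iff]
      constructor
      · rintro ⟨j, hj⟩
        have h1 : J + 1 < j + 1 := hw.oneDistribution_strictMono.lt_iff_lt.1 (by
          rw [hw.oneDistribution_succ, hc J le_rfl]; omega)
        obtain ⟨l, rfl⟩ : ∃ l, j = l + 1 := ⟨j - 1, by omega⟩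
        rw [hw.oneDistribution_succ, hc (l + 1) (by omega)] at hj
        exact ⟨l, by omega⟩
      · rintro ⟨j, hj⟩
        have h1 : J < j + 1 := hw.oneDistribution_strictMono.lt_iff_lt.1 (by omega)
        exact ⟨j + 1, by rw [hw.oneDistribution_succ, hc (j + 1) (by omega)]; omega⟩
    omega
  refine ⟨w.oneDistribution J + c, fun n => ?_⟩
  -- A start at or beyond `w.oneDistribution J + c` can be moved back by one period without changing
  -- the block.
  have hsub : w.subwords n ⊆ w.window n '' (range (w.oneDistribution J + c) : Finset ℕ) := by
    rw [subwords_eq_range]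
    rintro _ ⟨i, rfl⟩
    induction i using Nat.strong_induction_on with
    | _ i ih =>
      by_cases hi : i < w.oneDistribution J + c
      · exact ⟨i, by simpa using hi, rfl⟩
      · have h := ih (i - c) (by omega)
        have e : w.window n (i - c) = w.window n i := by
          ext1 k
          have := hper (i - c + k) (by omega)
          rw [show i - c + k + c = i + k by omega] at this
          exact this.symm
        rwa [e] at h
  refine (Set.ncard_le_ncard hsub (Set.toFinite _)).trans ((Set.ncard_image_le).trans ?_)
  rw [Set.ncard_coe_finset, card_range]

/-- A value taken infinitely often is, by blockwise injectivity, the only value from its first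
occurrence on. If all fibres are finite, the function tends to infinity. -/
theorem exists_eventually_const_or_tendsto {h : ℕ → ℕ} (hh : BlockwiseInjective h) :
    (∃ J c, ∀ j, J ≤ j → h j = c) ∨ Tendsto h atTop atTop := by
  by_cases hfin : ∀ v, {k | h k = v}.Finite
  · right
    rw [← Nat.cofinite_eq_atTop]
    exact Tendsto.cofinite_of_finite_preimage_singleton fun v => hfin v
  · left
    push Not at hfin
    obtain ⟨v, hv⟩ := hfin
    obtain ⟨i, hi⟩ := hv.nonempty
    refine ⟨i, v, fun j hij => ?_⟩
    obtain ⟨k, hk, hjk⟩ := hv.exists_gt j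
    have := hh i k (by omega) (hi.trans hk.symm) j hij hjk.le
    exact this.trans hi

theorem slope_of_complexity_eq (hw : w.HasInfinitelyManyOnes) (hg : BlockwiseInjective w.gap)
    {a b : ℤ} {N : ℕ} (hN : ∀ n : ℕ, N ≤ n → (w.complexity n : ℤ) = a * n + b) :
    2 ≤ a ∨ (a = 0 ∧ 1 ≤ b) := by
  rcases exists_eventually_const_or_tendsto hg with ⟨J, c, hc⟩ | ht
  · right
    obtain ⟨C, hC⟩ := hw.exists_complexity_le hc
    have h1 : a ≤ 0 := by
      by_contra h
      -- At this `n`, a slope `≥ 1` would give a value above the bound `C`.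
      have e := hN (N + C + b.natAbs + 1) (by omega)
      have := hC (N + C + b.natAbs + 1)
      push_cast at e
      nlinarith [abs_nonneg b, neg_abs_le b]
    have h2 : 0 ≤ a := by
      by_contra h
      have e := hN (N + b.natAbs) (by omega)
      have := w.complexity_pos (N + b.natAbs)
      push_cast at e
      nlinarith [abs_nonneg b, le_abs_self b]
    obtain rfl : a = 0 := le_antisymm h1 h2
    have e := hN N le_rfl
    have := w.complexity_pos N
    exact ⟨rfl, by omega⟩
  · left
    obtain ⟨N', hN'⟩ := hw.exists_add_le_complexity ht b.natAbs
    by_contra h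
    have e := hN (N + N') (by omega)
    have := hN' (N + N') (by omega)
    have h2 : a * ((N + N' : ℕ) : ℤ) ≤ 1 * ((N + N' : ℕ) : ℤ) :=
      mul_le_mul_of_nonneg_right (by omega) (by positivity)
    omega

end InfBinaryWord

/-! ### Sufficiency: words with prescribed gaps. -/

namespace InfBinaryWord

open Classical in
/-- The binary word with gap function `h`. -/
noncomputable def ofGaps (h : ℕ → ℕ) : InfBinaryWord :=
  fun i => if ∃ j, ∑ k ∈ range (j + 1), h k = i + 1 then 1 else 0

variable {h : ℕ → ℕ}

theorem ofGaps_eq_one_iff (i : ℕ) :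
    ofGaps h i = 1 ↔ ∃ j, ∑ k ∈ range (j + 1), h k = i + 1 := by
  simp [ofGaps]

theorem strictMono_sum_range_succ_sub_one (hpos : ∀ j, 0 < h j) :
    StrictMono fun j => ∑ k ∈ range (j + 1), h k - 1 := by
  refine strictMono_nat_of_lt_succ fun j => ?_
  have h1 := hpos (j + 1)
  have h2 := hpos j
  rw [sum_range_succ _ (j + 1), sum_range_succ]
  omega

theorem ofGaps_apply_sum_range (hpos : ∀ j, 0 < h j) (j : ℕ) :
    ofGaps h (∑ k ∈ range (j + 1), h k - 1) = 1 := by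
  refine (ofGaps_eq_one_iff _).2 ⟨j, ?_⟩
  have := hpos j
  rw [sum_range_succ]
  omega

theorem hasInfinitelyManyOnes_ofGaps (hpos : ∀ j, 0 < h j) :
    (ofGaps h).HasInfinitelyManyOnes := by
  refine (Set.infinite_range_of_injective
    (strictMono_sum_range_succ_sub_one hpos).injective).mono ?_
  rintro _ ⟨j, rfl⟩
  exact ofGaps_apply_sum_range hpos j

theorem oneDistribution_ofGaps (hpos : ∀ j, 0 < h j) (j : ℕ) :
    (ofGaps h).oneDistribution j = ∑ k ∈ range j, h k := by
  cases j with
  | zero => rfl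
  | succ j =>
    have key := Nat.nth_comp_of_strictMono (p := fun k => ofGaps h k = 1) (n := j)
      (strictMono_sum_range_succ_sub_one hpos) (fun i hi => by
        obtain ⟨l, hl⟩ := (ofGaps_eq_one_iff i).1 hi
        exact ⟨l, by simp only [hl]; omega⟩)
      (fun hfin => absurd hfin (hasInfinitelyManyOnes_ofGaps hpos))
    simp only [ofGaps_apply_sum_range hpos, Nat.nth_true] at key
    have := hpos j
    rw [oneDistribution, ← key, sum_range_succ]
    omega

theorem gap_ofGaps (hpos : ∀ j, 0 < h j) : (ofGaps h).gap = h := by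
  ext j
  rw [gap, oneDistribution_ofGaps hpos, oneDistribution_ofGaps hpos, sum_range_succ]
  omega

theorem complexity_ofGaps (hpos : ∀ j, 0 < h j) (hinj : Function.Injective h) {n J : ℕ}
    (hJ : ∀ j, J ≤ j → n ≤ h (j + 1)) :
    (ofGaps h).complexity n = n + 1 + ∑ j ∈ range J, min (h j) (n - h (j + 1)) := by
  rw [(hasInfinitelyManyOnes_ofGaps hpos).complexity_eq_sum (J := J), gap_ofGaps hpos]
  · rwa [gap_ofGaps hpos]
  · rwa [gap_ofGaps hpos]

/-- Both sides are the sum of `φ` over `range (k + J)`, split at `k` and at `J`. -/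
theorem sum_range_shift (φ : ℕ → ℕ) (k J : ℕ) :
    ∑ j ∈ range J, φ (k + j) + ∑ r ∈ range k, φ r =
      ∑ r ∈ range k, φ (J + r) + ∑ j ∈ range J, φ j := by
  rw [add_comm, ← sum_range_add, add_comm k J, sum_range_add, add_comm]

/-- If the gaps satisfy a Fibonacci-like recurrence with delay `m` after the first two of them,
then the complexity is eventually linear with slope `m + 1`. -/
theorem complexity_ofGaps_of_recurrence (hpos : ∀ j, 0 < h j) (hinj : Function.Injective h)
    {m : ℕ} (hrec : ∀ j, h (j + 2 + m + 1) = h (j + 2) + h (j + 3)) :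
    ∃ N, ∀ n, N ≤ n → (ofGaps h).complexity n + ∑ r ∈ range m, h (r + 3) =
      (m + 1) * n + 1 + h 0 + h 1 := by
  refine ⟨h 0 + h 1 + h 2 + ∑ r ∈ range m, h (r + 3), fun n hn => ?_⟩
  obtain ⟨J, hJ⟩ := eventually_atTop.1 (hinj.nat_tendsto_atTop.eventually_ge_atTop n)
  rw [complexity_ofGaps hpos hinj (J := J + 2) (fun j hj => hJ _ (by omega)),
    sum_range_succ', sum_range_succ']
  have h1 := sum_range_shift (fun j => min n (h (j + 3))) m J
  have h2 : ∑ r ∈ range m, min n (h (J + r + 3)) = m * n := by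
    rw [sum_congr rfl (g := fun _ => n) fun r _ => min_eq_left (hJ _ (by omega))]
    simp
  have h3 : ∑ r ∈ range m, min n (h (r + 3)) = ∑ r ∈ range m, h (r + 3) := by
    refine sum_congr rfl fun r hr => min_eq_right ?_
    have := single_le_sum (f := fun r => h (r + 3)) (fun _ _ => Nat.zero_le _) hr
    omega
  -- Termwise this is `min n (x + y) = min x (n - y) + min n y`; the recurrence turns `x + y` into
  -- the gap `m` places after `y`, so the sum telescopes.
  have h4 : ∑ j ∈ range J, min n (h (m + j + 3)) =
      ∑ j ∈ range J, min (h (j + 1 + 1)) (n - h (j + 1 + 1 + 1)) +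
        ∑ j ∈ range J, min n (h (j + 3)) := by
    rw [← sum_add_distrib]
    refine sum_congr rfl fun j _ => ?_
    have := hrec j
    rw [show m + j + 3 = j + 2 + m + 1 by omega, this]
    simp only [add_assoc, Nat.reduceAdd]
    omega
  simp only [zero_add, Nat.reduceAdd] at *
  rw [add_mul]
  omega

/-- An increasing solution of the recurrence `u (i + m + 2) = u i + u (i + 1)`. -/
def delayedFib (m : ℕ) : ℕ → ℕ
  | i => if i ≤ m + 1 then m + 2 + i else delayedFib m (i - (m + 2)) + delayedFib m (i - (m + 1))
termination_by i => i

theorem delayedFib_of_le {m i : ℕ} (hi : i ≤ m + 1) : delayedFib m i = m + 2 + i := by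
  rw [delayedFib, if_pos hi]

theorem delayedFib_add (m i : ℕ) :
    delayedFib m (i + m + 2) = delayedFib m i + delayedFib m (i + 1) := by
  rw [delayedFib, if_neg (by omega)]
  congr 2 <;> omega

/-- The initial values run from `m + 2` to `2m + 3`, and the first recursive value is `2m + 5`, so
monotonicity survives the junction and then propagates by the recurrence. -/
theorem delayedFib_strictMono (m : ℕ) : StrictMono (delayedFib m) := by
  refine strictMono_nat_of_lt_succ fun i => ?_
  induction i using Nat.strong_induction_on with
  | _ i ih =>
    rcases lt_trichotomy i (m + 1) with hi | rfl | hi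
    · rw [delayedFib_of_le (by omega), delayedFib_of_le (by omega)]
      omega
    · have := delayedFib_add m 0
      rw [delayedFib_of_le (i := 0) (by omega), delayedFib_of_le (i := 0 + 1) (by omega)] at this
      rw [delayedFib_of_le le_rfl, show m + 1 + 1 = 0 + m + 2 by omega, this]
      omega
    · obtain ⟨l, rfl⟩ : ∃ l, i = l + m + 2 := ⟨i - (m + 2), by omega⟩
      rw [show l + m + 2 + 1 = (l + 1) + m + 2 by omega, delayedFib_add, delayedFib_add]
      have h1 := ih l (by omega)
      have h2 := ih (l + 1) (by omega)
      omega

/-- The gap sequence `c, x, M u₀, M u₁, …` with `u = delayedFib m`. -/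
def prefixedGaps (m c x M : ℕ) : ℕ → ℕ
  | 0 => c
  | 1 => x
  | i + 2 => M * delayedFib m i

/-- Scaling by `M` keeps the recurrence while the two free gaps, not being multiples of `M`, cannot
collide with the tail. -/
theorem prefixedGaps_injective {m c x M : ℕ} (hM : 0 < M) (hc : ¬ M ∣ c) (hx : ¬ M ∣ x)
    (hcx : c ≠ x) : Function.Injective (prefixedGaps m c x M) := by
  intro i j hij
  match i, j with
  | 0, 0 => rfl
  | 1, 1 => rfl
  | 0, 1 => exact absurd hij hcx
  | 1, 0 => exact absurd hij.symm hcx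
  | 0, j + 2 => exact absurd ⟨_, hij⟩ hc
  | 1, j + 2 => exact absurd ⟨_, hij⟩ hx
  | i + 2, 0 => exact absurd ⟨_, hij.symm⟩ hc
  | i + 2, 1 => exact absurd ⟨_, hij.symm⟩ hx
  | i + 2, j + 2 =>
    have := (delayedFib_strictMono m).injective (Nat.eq_of_mul_eq_mul_left hM hij)
    omega

theorem prefixedGaps_pos {m c x M : ℕ} (hM : 0 < M) (hc : ¬ M ∣ c) (hx : ¬ M ∣ x) (j : ℕ) :
    0 < prefixedGaps m c x M j := by
  match j with
  | 0 => exact Nat.pos_of_ne_zero fun (h : c = 0) => hc (h ▸ dvd_zero _)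
  | 1 => exact Nat.pos_of_ne_zero fun (h : x = 0) => hx (h ▸ dvd_zero _)
  | j + 2 =>
    refine Nat.mul_pos hM (lt_of_lt_of_le ?_ ((delayedFib_strictMono m).monotone (Nat.zero_le j)))
    rw [delayedFib_of_le (by omega)]
    omega

/-! ### Realising every admissible pair. -/

theorem exists_complexity_eq_of_two_le {a : ℤ} (b : ℤ) (ha : 2 ≤ a) :
    ∃ w : InfBinaryWord, w.HasInfinitelyManyOnes ∧ BlockwiseInjective w.gap ∧
      ∃ N : ℕ, 0 < N ∧ ∀ n : ℕ, N ≤ n → (w.complexity n : ℤ) = a * n + b := by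
  obtain ⟨m, rfl⟩ : ∃ m : ℕ, a = m + 2 := ⟨(a - 2).toNat, by omega⟩
  obtain ⟨M, hMdef⟩ : ∃ M : ℕ, M = b.natAbs + 4 := ⟨_, rfl⟩
  obtain ⟨T, hT⟩ : ∃ T, T = ∑ r ∈ range (m + 1), delayedFib m (r + 1) := ⟨_, rfl⟩
  have hM : 0 < M := by omega
  have hT3 : M * 3 ≤ M * T := by
    refine Nat.mul_le_mul_left M ?_
    rw [hT, sum_range_succ', delayedFib_of_le (by omega)]
    omega
  -- Since `x ≡ b - 1 - c` modulo `M` and `|b - 1 - c| < M`, a nonzero `b - 1 - c` ensures `M ∤ x`;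
  -- one of `c = 1, 2` always works.
  obtain ⟨c, hc1, hc2, hcb⟩ : ∃ c : ℕ, 1 ≤ c ∧ c ≤ 2 ∧ b - 1 - c ≠ 0 := by
    by_cases hb : b = 2
    · exact ⟨2, by omega, by omega, by omega⟩
    · exact ⟨1, by omega, by omega, by omega⟩
  -- The constant term is `1 + c + x - M * T`; this `x` makes it `b`. As `T ≥ 3`, `x` is also larger
  -- than `c`.
  obtain ⟨x, hx⟩ : ∃ x : ℕ, (x : ℤ) = (M : ℤ) * T + (b - 1 - c) :=
    ⟨((M : ℤ) * T + (b - 1 - c)).toNat, by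
      rw [Int.toNat_of_nonneg]; zify at hT3; omega⟩
  have hc : ¬ M ∣ c := Nat.not_dvd_of_pos_of_lt (by omega) (by omega)
  have hMx : ¬ M ∣ x := by
    rw [← Int.natCast_dvd_natCast, hx, Int.dvd_add_right (dvd_mul_right _ _)]
    intro hd
    have := Int.natAbs_le_of_dvd_ne_zero hd hcb
    omega
  have hcx : c ≠ x := by
    zify at hT3 ⊢
    omega
  have hpos := prefixedGaps_pos (m := m) hM hc hMx
  have hinj := prefixedGaps_injective (m := m) hM hc hMx hcx
  obtain ⟨N, hN⟩ := complexity_ofGaps_of_recurrence (m := m + 1) hpos hinj fun j => by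
    rw [show j + 2 + (m + 1) + 1 = (j + m + 2) + 2 by omega]
    simp only [prefixedGaps, delayedFib_add, mul_add]
  refine ⟨_, hasInfinitelyManyOnes_ofGaps hpos, ?_, N + 1, by omega, fun n hn => ?_⟩
  · rw [gap_ofGaps hpos]
    intro i j hij h
    exact absurd (hinj h) hij.ne
  · have h1 := hN n (by omega)
    simp only [prefixedGaps, ← mul_sum, ← hT] at h1
    zify at h1
    linarith

theorem exists_complexity_eq_of_one_le {b : ℤ} (hb : 1 ≤ b) :
    ∃ w : InfBinaryWord, w.HasInfinitelyManyOnes ∧ BlockwiseInjective w.gap ∧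
      ∃ N : ℕ, 0 < N ∧ ∀ n : ℕ, N ≤ n → (w.complexity n : ℤ) = b := by
  obtain ⟨m, rfl⟩ : ∃ m : ℕ, b = m + 1 := ⟨(b - 1).toNat, by omega⟩
  -- These are the gaps of `0^m 1 1 1 ⋯`.
  let h : ℕ → ℕ := fun j => if j = 0 then m + 1 else 1
  have hpos : ∀ j, 0 < h j := fun j => by simp only [h]; split_ifs <;> omega
  have hw : ∀ i, ofGaps h i = if i < m then 0 else 1 := by
    intro i
    have hsum : ∀ j, ∑ k ∈ range (j + 1), h k = m + 1 + j := fun j => by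
      rw [sum_range_succ']
      simp [h]
      omega
    split_ifs with hi
    · refine eq_zero_of_ne_one fun h1 => ?_
      obtain ⟨j, hj⟩ := (ofGaps_eq_one_iff i).1 h1
      rw [hsum] at hj
      omega
    · exact (ofGaps_eq_one_iff i).2 ⟨i - m, by rw [hsum]; omega⟩
  refine ⟨_, hasInfinitelyManyOnes_ofGaps hpos, ?_, m + 1, by omega, fun n hn => ?_⟩
  · rw [gap_ofGaps hpos]
    intro i j hij he k hik hkj
    simp only [h] at *
    split_ifs at * <;> omega
  · have hsub : (ofGaps h).subwords n = (ofGaps h).window n '' (range (m + 1) : Finset ℕ) := by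
      rw [subwords_eq_range]
      refine Set.Subset.antisymm ?_ (Set.image_subset_range _ _)
      rintro _ ⟨i, rfl⟩
      -- All starts from `m` on give the all-ones block.
      refine ⟨min i m, by simp, ?_⟩
      ext1 k
      simp only [window, hw]
      congr 1
      simp only [eq_iff_iff]
      omega
    rw [complexity, hsub, Set.InjOn.ncard_image, Set.ncard_coe_finset, card_range]
    · simp
    · intro i hi i' hi' he
      simp only [coe_range, Set.mem_Iio] at hi hi'
      have key : ∀ k, k < n → (i + k < m ↔ i' + k < m) := by
        intro k hk
        have := congrFun he ⟨k, hk⟩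
        simp only [window, hw] at this
        split_ifs at this <;> omega
      have h1 := key (m - i)
      have h2 := key (m - i')
      omega

end InfBinaryWord

theorem mainTheorem4 (a b : ℤ) :
    (∃ w : InfBinaryWord,
        w.HasInfinitelyManyOnes ∧
        BlockwiseInjective w.gap ∧
        ∃ N : ℕ, 0 < N ∧ ∀ n : ℕ, N ≤ n → (w.complexity n : ℤ) = a * (n : ℤ) + b) ↔
      (2 ≤ a ∨ (a = 0 ∧ 1 ≤ b)) := by
  constructor
  · rintro ⟨w, hw, hg, N, -, hN⟩
    exact InfBinaryWord.slope_of_complexity_eq hw hg hN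
  · rintro (ha | ⟨rfl, hb⟩)
    · exact InfBinaryWord.exists_complexity_eq_of_two_le b ha
    · simpa using InfBinaryWord.exists_complexity_eq_of_one_le hb
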